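/- All rings are associative with unit, ring homomorphisms preserve the unit, and modules are left modules. A ring extension $\iota\colon R\hookrightarrow A$ (an injective ring homomorphism, written $R\subset A$) is a *Frobenius extension* if there are an $R$-$R$-bimodule homomorphism $\tau\colon A\to R$ and finitely many elements $x_i,y_i\in A$ such that $\sum_i x_i\tau(y_ia)=a$ and $\sum_i\tau(ax_i)y_i=a$ for all $a\in A$. Let $\Lambda$ be a ring. A $\Lambda$-module $M$ is *Gorenstein projective* if $M\cong\mathrm{Ker}(P_0\to P_{-1})$ for an acyclic complex $\cdots\to P_1\to P_0\to P_{-1}\to\cdots$ of projective $\Lambda$-modules that remains acyclic under $\mathrm{Hom}_\Lambda(-,Q)$ for every projective $\Lambda$-module $Q$. Dually, $M$ is *Gorenstein injective* if $M\cong\mathrm{Ker}(I_0\to I_{-1})$ for an acyclic complex $\cdots\to I_1\to I_0\to I_{-1}\to\cdots$ of injective $\Lambda$-modules that remains acyclic under $\mathrm{Hom}_\Lambda(J,-)$ for every injective $\Lambda$-module $J$. The *Gorenstein projective dimension* $\mathrm{G\text{-}proj.dim}_\Lambda M\in\mathbb N\cup\{\infty\}$ is the least $n\in\mathbb N$ for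 which there is an exact sequence $0\to G_n\to\cdots\to G_0\to M\to 0$ with all $G_i$ Gorenstein projective, and $\infty$ if there is no such $n$. The *Gorenstein injective dimension* $\mathrm{G\text{-}inj.dim}_\Lambda M\in\mathbb N\cup\{\infty\}$ is the least $n\in\mathbb N$ for which there is an exact sequence $0\to M\to E^0\to\cdots\to E^n\to 0$ with all $E^i$ Gorenstein injective, and $\infty$ if there is no such $n$. **Proposition.** Let $R\subset A$ be a Frobenius extension of rings and let $M$ be a left $A$-module, regarded also as a left $R$-module by restriction of scalars. If $\mathrm{G\text{-}proj.dim}_A M<\infty$, then $\mathrm{G\text{-}proj.dim}_A M=\mathrm{G\text{-}proj.dim}_R M$. Dually, if $\mathrm{G\text{-}inj.dim}_A M<\infty$, then $\mathrm{G\text{-}inj.dim}_A M=\mathrm{G\text{-}inj.dim}_R M$. -/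

import Mathlib

open CategoryTheory CategoryTheory.Limits

universe u₁ u₂ w

section Abelian

variable {C : Type*} [Category C] [Abelian C]

/-- A complex `⋯ ⟶ P₁ ⟶ P₀ ⟶ P₋₁ ⟶ ⋯` of projective objects is totally acyclic if it is acyclic
and for every projective object `Q` the complex of abelian groups `Hom(P, Q)` is acyclic. The
latter is spelled out at each spot: every `f : Pₙ ⟶ Q` which vanishes on composing with
`Pₙ₊₁ ⟶ Pₙ` factors through `Pₙ ⟶ Pₙ₋₁`. -/
structure IsTotallyAcyclicProjective (P : ChainComplex C ℤ) : Prop where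
  projective : ∀ n : ℤ, Projective (P.X n)
  acyclic : P.Acyclic
  hom_acyclic : ∀ (Q : C), Projective Q → ∀ (n : ℤ) (f : P.X n ⟶ Q),
    P.d (n + 1) n ≫ f = 0 → ∃ g : P.X (n - 1) ⟶ Q, P.d n (n - 1) ≫ g = f

/-- A complex `⋯ ⟶ I₁ ⟶ I₀ ⟶ I₋₁ ⟶ ⋯` of injective objects is totally acyclic if it is acyclic
and for every injective object `J` the complex of abelian groups `Hom(J, I)` is acyclic: every
`f : J ⟶ Iₙ` which vanishes on composing with `Iₙ ⟶ Iₙ₋₁` factors through `Iₙ₊₁ ⟶ Iₙ`. -/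
structure IsTotallyAcyclicInjective (I : ChainComplex C ℤ) : Prop where
  injective : ∀ n : ℤ, Injective (I.X n)
  acyclic : I.Acyclic
  hom_acyclic : ∀ (J : C), Injective J → ∀ (n : ℤ) (f : J ⟶ I.X n),
    f ≫ I.d n (n - 1) = 0 → ∃ g : J ⟶ I.X (n + 1), g ≫ I.d (n + 1) n = f

/-- `M` is Gorenstein projective if `M ≅ Ker(P₀ ⟶ P₋₁)` for a totally acyclic complex `P` of
projective objects. -/
def IsGorensteinProjective (M : C) : Prop :=
  ∃ P : ChainComplex C ℤ, IsTotallyAcyclicProjective P ∧ Nonempty (M ≅ kernel (P.d 0 (-1)))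

/-- `M` is Gorenstein injective if `M ≅ Ker(I₀ ⟶ I₋₁)` for a totally acyclic complex `I` of
injective objects. -/
def IsGorensteinInjective (M : C) : Prop :=
  ∃ I : ChainComplex C ℤ, IsTotallyAcyclicInjective I ∧ Nonempty (M ≅ kernel (I.d 0 (-1)))

/-- There is an exact sequence `0 ⟶ Gₙ ⟶ ⋯ ⟶ G₁ ⟶ G₀ ⟶ M ⟶ 0` with all `Gᵢ` Gorenstein
projective. The sequence is continued to the left by zero objects. -/
def HasGorensteinProjectiveResolution (M : C) (n : ℕ) : Prop :=
  ∃ (G : ChainComplex C ℕ) (ε : G.X 0 ⟶ M) (h : G.d 1 0 ≫ ε = 0),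
    (∀ i, IsGorensteinProjective (G.X i)) ∧ (∀ i, n < i → IsZero (G.X i)) ∧
    (∀ i, G.ExactAt (i + 1)) ∧ (ShortComplex.mk (G.d 1 0) ε h).Exact ∧ Epi ε

/-- There is an exact sequence `0 ⟶ M ⟶ E⁰ ⟶ E¹ ⟶ ⋯ ⟶ Eⁿ ⟶ 0` with all `Eⁱ` Gorenstein
injective. The sequence is continued to the right by zero objects. -/
def HasGorensteinInjectiveResolution (M : C) (n : ℕ) : Prop :=
  ∃ (E : CochainComplex C ℕ) (η : M ⟶ E.X 0) (h : η ≫ E.d 0 1 = 0),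
    (∀ i, IsGorensteinInjective (E.X i)) ∧ (∀ i, n < i → IsZero (E.X i)) ∧
    (∀ i, E.ExactAt (i + 1)) ∧ (ShortComplex.mk η (E.d 0 1) h).Exact ∧ Mono η

/-- The Gorenstein projective dimension: the least length of a Gorenstein projective resolution,
and `∞` if there is none of finite length. -/
noncomputable def gorensteinProjectiveDimension (M : C) : ℕ∞ :=
  ⨅ (n : ℕ) (_ : HasGorensteinProjectiveResolution M n), (n : ℕ∞)

/-- The Gorenstein injective dimension: the least length of a Gorenstein injective resolution,
and `∞` if there is none of finite length. -/
noncomputable def gorensteinInjectiveDimension (M : C) : ℕ∞ :=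
  ⨅ (n : ℕ) (_ : HasGorensteinInjectiveResolution M n), (n : ℕ∞)

end Abelian

/-- The ring extension `ι : R ↪ A` is a Frobenius extension: there are an `R`-`R`-bimodule
homomorphism `τ : A → R` and finitely many `xᵢ, yᵢ ∈ A` such that `∑ᵢ xᵢ τ(yᵢ a) = a` and
`∑ᵢ τ(a xᵢ) yᵢ = a` for all `a ∈ A`. -/
structure IsFrobeniusExtension {R : Type*} {A : Type*} [Ring R] [Ring A] (ι : R →+* A) : Prop where
  injective : Function.Injective ι
  exists_system : ∃ (τ : A →+ R) (k : ℕ) (x y : Fin k → A),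
    (∀ (r s : R) (a : A), τ (ι r * a * ι s) = r * τ a * s) ∧
    (∀ a : A, ∑ i, x i * ι (τ (y i * a)) = a) ∧
    (∀ a : A, ∑ i, ι (τ (a * x i)) * y i = a)

/-!
Let `F` be restriction of scalars along the Frobenius extension `R → A` and `G = Hom_R(A, -)` its
right adjoint. The Frobenius system makes `G` a left adjoint of `F` as well: the unit is
`n ↦ (a ↦ τ(a) n)` and the counit `φ ↦ ∑ xᵢ φ(yᵢ)` (`IsFrobeniusExtension.nonempty_adjunction`).
The rest of the argument takes place in abelian categories with enough projectives and uses only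
`F ⊣ G ⊣ F` and that `F` is faithful.

Both functors are exact and preserve projectives, and `Hom(F P, Q) = Hom(P, G Q)`. So `F`
preserves totally acyclic complexes and Gorenstein projective resolutions
(`GorensteinProjectiveDimensionLT.map`), and the dimension of `F M` is at most that of `M`.

For the other inequality, a finite Gorenstein projective dimension is detected by the vanishing
of `Extⁱ(M, Q)` for projective `Q`
(`GorensteinProjectiveDimensionLT.of_extProjectiveVanishesFrom`). If `F M` has dimension at most
`m`, then `Extⁱ(M, G (F Q)) = Extⁱ(F M, F Q) = 0` for `i > m`. Because `F` is faithful, the counit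
`G (F Q) ⟶ Q` is an epimorphism, hence the projective `Q` is a summand of `G (F Q)` and
`Extⁱ(M, Q) = 0` (`ExtProjectiveVanishesFrom.of_map`). As `M` has finite dimension, its dimension
is then at most `m`.

The detection by `Ext` rests on a coinductive description of Gorenstein projective objects
(`isGorensteinProjective_of_coinduction`): a class of objects without higher `Ext` into
projectives, each of which embeds into a projective with cokernel in the class, consists of
Gorenstein projectives. From this follow the closure under extensions
(`IsGorensteinProjective.of_extension`) and under those cokernels of monomorphisms that have no
higher `Ext` into projectives (`IsGorensteinProjective.of_quotient`).

The statement on Gorenstein injective dimensions is the one on Gorenstein projective dimensions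
for the opposite categories, with the adjunctions `F.op ⊣ G.op ⊣ F.op`.
-/

/-! ### Splicing short exact sequences -/

section ShortExactSequences

variable {C : Type*} [Category C] [Abelian C]

lemma shortExact_of_desc {X Y Z : C} {f : X ⟶ Y} {g : Y ⟶ Z} (w : f ≫ g = 0) (hf : Mono f)
    (hg : Epi g) (H : ∀ {T : C} (t : Y ⟶ T), f ≫ t = 0 → ∃ u : Z ⟶ T, g ≫ u = t) :
    (ShortComplex.mk f g w).ShortExact := by
  refine ShortComplex.ShortExact.mk' (ShortComplex.exact_of_g_is_cokernel _ ?_) hf hg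
  exact CokernelCofork.IsColimit.ofπ g w (fun t ht => (H t ht).choose)
    (fun t ht => (H t ht).choose_spec)
    (fun t ht m hm => by rw [← cancel_epi g, hm, (H t ht).choose_spec])

lemma CategoryTheory.ShortComplex.ShortExact.exists_desc {X Y Z : C} {f : X ⟶ Y} {g : Y ⟶ Z}
    {w : f ≫ g = 0} (h : (ShortComplex.mk f g w).ShortExact) {T : C} (t : Y ⟶ T)
    (ht : f ≫ t = 0) : ∃ u : Z ⟶ T, g ≫ u = t :=
  ⟨h.gIsCokernel.desc (CokernelCofork.ofπ t ht), h.gIsCokernel.fac _ WalkingParallelPair.one⟩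

lemma CategoryTheory.ShortComplex.ShortExact.exists_lift {X Y Z : C} {f : X ⟶ Y} {g : Y ⟶ Z}
    {w : f ≫ g = 0} (h : (ShortComplex.mk f g w).ShortExact) {T : C} (t : T ⟶ Y)
    (ht : t ≫ g = 0) : ∃ u : T ⟶ X, u ≫ f = t :=
  ⟨h.fIsKernel.lift (KernelFork.ofι t ht), h.fIsKernel.fac _ WalkingParallelPair.zero⟩

lemma exact_comp_mono {X Y Z W : C} {f : X ⟶ Y} {g : Y ⟶ Z} (w : f ≫ g = 0)
    (m : Z ⟶ W) [Mono m] {g' : Y ⟶ W} (hg : g' = g ≫ m) (w' : f ≫ g' = 0) :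
    (ShortComplex.mk f g' w').Exact ↔ (ShortComplex.mk f g w).Exact := by
  let φ : ShortComplex.mk f g w ⟶ ShortComplex.mk f g' w' :=
    { τ₁ := 𝟙 _, τ₂ := 𝟙 _, τ₃ := m, comm₂₃ := by simpa using hg }
  have : Mono φ.τ₃ := ‹Mono m›
  have : IsIso φ.τ₂ := inferInstanceAs (IsIso (𝟙 _))
  have : Epi φ.τ₁ := inferInstanceAs (Epi (𝟙 _))
  exact (ShortComplex.exact_iff_of_epi_of_isIso_of_mono φ).symm

lemma exact_epi_comp {X Y Z W : C} {f : X ⟶ Y} {g : Y ⟶ Z} (w : f ≫ g = 0)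
    (e : W ⟶ X) [Epi e] {f' : W ⟶ Y} (hf : f' = e ≫ f) (w' : f' ≫ g = 0) :
    (ShortComplex.mk f' g w').Exact ↔ (ShortComplex.mk f g w).Exact := by
  let φ : ShortComplex.mk f' g w' ⟶ ShortComplex.mk f g w :=
    { τ₁ := e, τ₂ := 𝟙 _, τ₃ := 𝟙 _, comm₁₂ := by simpa using hf.symm }
  have : Epi φ.τ₁ := ‹Epi e›
  have : IsIso φ.τ₂ := inferInstanceAs (IsIso (𝟙 _))
  have : Mono φ.τ₃ := inferInstanceAs (Mono (𝟙 _))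
  exact ShortComplex.exact_iff_of_epi_of_isIso_of_mono φ

lemma nonempty_kernel_iso_of_shortExact {X Y Z W : C} {f : X ⟶ Y} {g : Y ⟶ Z} {w : f ≫ g = 0}
    (h : (ShortComplex.mk f g w).ShortExact) {m : Z ⟶ W} (hm : Mono m) (k : Y ⟶ W)
    (hk : k = g ≫ m) : Nonempty (kernel k ≅ X) := by
  subst hk
  exact ⟨kernelCompMono g m ≪≫
    (kernelIsKernel g).conePointUniqueUpToIso h.fIsKernel⟩

lemma ChainComplex.exactAt_int_iff (K : ChainComplex C ℤ) (n : ℤ) :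
    K.ExactAt (n + 1) ↔
      (ShortComplex.mk (K.d (n + 1 + 1) (n + 1)) (K.d (n + 1) n) (K.d_comp_d _ _ _)).Exact :=
  HomologicalComplex.exactAt_iff' _ (n + 1 + 1) (n + 1) n (by simp) (by simp)

lemma ChainComplex.exactAt_nat_iff (K : ChainComplex C ℕ) (n : ℕ) :
    K.ExactAt (n + 1) ↔
      (ShortComplex.mk (K.d (n + 1 + 1) (n + 1)) (K.d (n + 1) n) (K.d_comp_d _ _ _)).Exact :=
  HomologicalComplex.exactAt_iff' _ (n + 1 + 1) (n + 1) n (by simp) (by simp)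

section Splice

/-- Exact sequences `0 ⟶ Xₙ₊₁ ⟶ Qₙ ⟶ Xₙ ⟶ 0`, where `n` runs through the integers, are spliced
into a complex `⋯ ⟶ Q₁ ⟶ Q₀ ⟶ Q₋₁ ⟶ ⋯`. The predicate `R` carries along any property of the
sequences. -/
lemma exists_splice (X : ℤ → C) (R : ∀ (n : ℤ) (Q : C), (X (n + 1) ⟶ Q) → (Q ⟶ X n) → Prop)
    (H : ∀ n, ∃ (Q : C) (i : X (n + 1) ⟶ Q) (p : Q ⟶ X n) (w : i ≫ p = 0),
      (ShortComplex.mk i p w).ShortExact ∧ R n Q i p) :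
    ∃ (K : ChainComplex C ℤ) (i : ∀ n, X (n + 1) ⟶ K.X n) (p : ∀ n, K.X n ⟶ X n)
      (w : ∀ n, i n ≫ p n = 0), (∀ n, (ShortComplex.mk (i n) (p n) (w n)).ShortExact) ∧
      (∀ n, K.d (n + 1) n = p (n + 1) ≫ i n) ∧ ∀ n, R n (K.X n) (i n) (p n) := by
  choose Q i p w h hR using H
  refine ⟨ChainComplex.of Q (fun n => p (n + 1) ≫ i n) (fun n => ?_), i, p, w, h, fun n => ?_, hR⟩
  · rw [Category.assoc, reassoc_of% (w (n + 1)), zero_comp, comp_zero]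
  · exact ChainComplex.of_d Q (fun n => p (n + 1) ≫ i n) n

variable {K : ChainComplex C ℤ} {X : ℤ → C} {i : ∀ n, X (n + 1) ⟶ K.X n}
  {p : ∀ n, K.X n ⟶ X n} {w : ∀ n, i n ≫ p n = 0}
  (h : ∀ n, (ShortComplex.mk (i n) (p n) (w n)).ShortExact)
  (hd : ∀ n, K.d (n + 1) n = p (n + 1) ≫ i n)
include h hd

lemma acyclic_of_splice : K.Acyclic := by
  intro n
  obtain ⟨m, rfl⟩ : ∃ m, n = m + 1 := ⟨n - 1, by omega⟩
  rw [ChainComplex.exactAt_int_iff]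
  have : Epi (p (m + 1 + 1)) := (h (m + 1 + 1)).epi_g
  have : Mono (i m) := (h m).mono_f
  rw [exact_comp_mono (by rw [hd, Category.assoc, w, comp_zero]) (i m) (hd m),
    exact_epi_comp (w (m + 1)) (p (m + 1 + 1)) (hd (m + 1))]
  exact (h (m + 1)).exact

lemma nonempty_kernel_iso_of_splice {n m : ℤ} (hm : m + 1 = n) :
    Nonempty (kernel (K.d n m) ≅ X (n + 1)) := by
  subst hm
  exact nonempty_kernel_iso_of_shortExact (h (m + 1)) (h m).mono_f _ (hd m)

end Splice

section Unsplice

variable (K : ChainComplex C ℤ)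

/-- The map from the cokernel of `Kₙ₊₂ ⟶ Kₙ₊₁` to `Kₙ` induced by the differential. If `K` is
acyclic, it identifies this cokernel with the cycles in `Kₙ`. -/
noncomputable def cokernelToX (n : ℤ) :
    cokernel (K.d (n + 1 + 1) (n + 1)) ⟶ K.X n :=
  cokernel.desc _ (K.d (n + 1) n) (K.d_comp_d _ _ _)

lemma π_cokernelToX (n : ℤ) :
    cokernel.π (K.d (n + 1 + 1) (n + 1)) ≫ cokernelToX K n = K.d (n + 1) n :=
  cokernel.π_desc _ _ _

lemma cokernelToX_π (n : ℤ) : cokernelToX K n ≫ cokernel.π (K.d (n + 1) n) = 0 := by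
  rw [← cancel_epi (cokernel.π _), reassoc_of% (π_cokernelToX K n), cokernel.condition, comp_zero]

variable {K}

lemma shortExact_cokernelToX (hK : K.Acyclic) (n : ℤ) :
    (ShortComplex.mk (cokernelToX K n) (cokernel.π (K.d (n + 1) n))
      (cokernelToX_π K n)).ShortExact := by
  refine ShortComplex.ShortExact.mk' ?_ ?_ (inferInstanceAs (Epi (cokernel.π _)))
  · exact (exact_epi_comp _ (cokernel.π (K.d (n + 1 + 1) (n + 1))) (π_cokernelToX K n).symm _).1
      (ShortComplex.exact_cokernel (K.d (n + 1) n))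
  · have := hK (n + 1)
    rw [ChainComplex.exactAt_int_iff] at this
    exact this.mono_cokernelDesc

lemma nonempty_kernel_iso_cokernel (hK : K.Acyclic) {n m : ℤ} (hm : m + 1 = n) :
    Nonempty (kernel (K.d n m) ≅ cokernel (K.d (n + 1 + 1) (n + 1))) := by
  subst hm
  exact nonempty_kernel_iso_of_shortExact (shortExact_cokernelToX hK (m + 1))
    (shortExact_cokernelToX hK m).mono_f _ (π_cokernelToX K m).symm

end Unsplice

end ShortExactSequences

/-! ### Gorenstein projective objects as chains of short exact sequences -/

section GorensteinSequences

variable {C : Type*} [Category C] [Abelian C]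

/-- There is an exact sequence `0 ⟶ X ⟶ P ⟶ Y ⟶ 0` with `P` projective which stays exact
under `Hom(-, Q)` for every projective `Q`. -/
def ProjectiveStep (X Y : C) : Prop :=
  ∃ (P : C) (f : X ⟶ P) (g : P ⟶ Y) (w : f ≫ g = 0), (ShortComplex.mk f g w).ShortExact ∧
    Projective P ∧ ∀ Q : C, Projective Q → ∀ φ : X ⟶ Q, ∃ ψ : P ⟶ Q, f ≫ ψ = φ

/-- There is an exact sequence `0 ⟶ X ⟶ I ⟶ Y ⟶ 0` with `I` injective which stays exact
under `Hom(J, -)` for every injective `J`. -/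
def InjectiveStep (X Y : C) : Prop :=
  ∃ (I : C) (f : X ⟶ I) (g : I ⟶ Y) (w : f ≫ g = 0), (ShortComplex.mk f g w).ShortExact ∧
    Injective I ∧ ∀ J : C, Injective J → ∀ φ : J ⟶ Y, ∃ ψ : J ⟶ I, ψ ≫ g = φ

lemma InjectiveStep.op {X Y : C} (h : InjectiveStep X Y) :
    ProjectiveStep (Opposite.op Y) (Opposite.op X) := by
  obtain ⟨I, f, g, w, hS, hI, hJ⟩ := h
  refine ⟨Opposite.op I, g.op, f.op, by rw [← op_comp, w, op_zero], hS.op, inferInstance, ?_⟩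
  intro Q hQ φ
  obtain ⟨ψ, hψ⟩ := hJ Q.unop inferInstance φ.unop
  exact ⟨ψ.op, Quiver.Hom.unop_inj hψ⟩

lemma ProjectiveStep.unop {X Y : Cᵒᵖ} (h : ProjectiveStep X Y) :
    InjectiveStep Y.unop X.unop := by
  obtain ⟨P, f, g, w, hS, hP, hQ⟩ := h
  refine ⟨P.unop, g.unop, f.unop, by rw [← unop_comp, w, unop_zero], hS.unop, inferInstance, ?_⟩
  intro J hJ φ
  obtain ⟨ψ, hψ⟩ := hQ (Opposite.op J) inferInstance φ.op
  exact ⟨ψ.unop, Quiver.Hom.op_inj hψ⟩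

/-- An object is Gorenstein projective iff it occurs in a family of objects indexed by the
integers in which neighbours are linked by `ProjectiveStep`. These are the cycles of a totally
acyclic complex. Unlike complexes, such families are easily modified at one end and pass
to the opposite category by `n ↦ -n`. -/
lemma isGorensteinProjective_iff (M : C) : IsGorensteinProjective M ↔
    ∃ X : ℤ → C, Nonempty (M ≅ X 0) ∧ ∀ n, ProjectiveStep (X (n + 1)) (X n) := by
  constructor
  · rintro ⟨K, hK, ⟨e⟩⟩
    obtain ⟨e'⟩ := nonempty_kernel_iso_cokernel hK.acyclic (neg_add_cancel 1)
    refine ⟨fun n => cokernel (K.d (n + 1 + 1) (n + 1)), ⟨e ≪≫ e'⟩, fun n => ?_⟩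
    refine ⟨_, _, _, _, shortExact_cokernelToX hK.acyclic (n + 1), hK.projective _, ?_⟩
    intro Q hQ φ
    have := hK.hom_acyclic Q hQ (n + 1 + 1) (cokernel.π _ ≫ φ) (by simp)
    generalize hm : n + 1 + 1 - 1 = m at this
    obtain rfl : m = n + 1 := by omega
    obtain ⟨ψ, hψ⟩ := this
    refine ⟨ψ, ?_⟩
    rw [← cancel_epi (cokernel.π _), reassoc_of% (π_cokernelToX K (n + 1)), hψ]
  · rintro ⟨Y, ⟨e⟩, hY⟩
    obtain ⟨X, rfl⟩ : ∃ X : ℤ → C, Y = fun n => X (n + 1) :=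
      ⟨fun n => Y (n - 1), by ext n; simp⟩
    have hX : ∀ n, ProjectiveStep (X (n + 1)) (X n) := fun n => by
      simpa using hY (n - 1)
    obtain ⟨K, i, p, w, h, hd, hR⟩ := exists_splice X _ hX
    obtain ⟨e'⟩ := nonempty_kernel_iso_of_splice h hd (neg_add_cancel 1)
    refine ⟨K, ⟨fun n => (hR n).1, acyclic_of_splice h hd, ?_⟩, ⟨e ≪≫ e'.symm⟩⟩
    intro J hJ n f hf
    generalize hm : n - 1 = m
    obtain rfl : n = m + 1 := by omega
    rw [hd, Category.assoc] at hf
    have : Epi (p (m + 1 + 1)) := (h (m + 1 + 1)).epi_g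
    have hf' : i (m + 1) ≫ f = 0 := by
      rw [← cancel_epi (p (m + 1 + 1)), hf, comp_zero]
    obtain ⟨g, hg⟩ := (h (m + 1)).exists_desc f hf'
    obtain ⟨ψ, hψ⟩ := (hR m).2 J hJ g
    refine ⟨ψ, ?_⟩
    rw [hd, Category.assoc, hψ, hg]

/-- The dual of `isGorensteinProjective_iff`. -/
lemma isGorensteinInjective_iff (M : C) : IsGorensteinInjective M ↔
    ∃ X : ℤ → C, Nonempty (M ≅ X 0) ∧ ∀ n, InjectiveStep (X (n + 1)) (X n) := by
  constructor
  · rintro ⟨K, hK, ⟨e⟩⟩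
    obtain ⟨e'⟩ := nonempty_kernel_iso_cokernel hK.acyclic (neg_add_cancel 1)
    refine ⟨fun n => cokernel (K.d (n + 1 + 1) (n + 1)), ⟨e ≪≫ e'⟩, fun n => ?_⟩
    refine ⟨_, _, _, _, shortExact_cokernelToX hK.acyclic (n + 1), hK.injective _, ?_⟩
    intro J hJ φ
    have hmono := (shortExact_cokernelToX hK.acyclic n).mono_f
    have hzero : (φ ≫ cokernelToX K n) ≫ K.d n (n - 1) = 0 := by
      generalize hm : n - 1 = m
      obtain rfl : n = m + 1 := by omega
      rw [Category.assoc, ← π_cokernelToX, reassoc_of% (cokernelToX_π K (m + 1)), zero_comp,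
        comp_zero]
    obtain ⟨ψ, hψ⟩ := hK.hom_acyclic J hJ n (φ ≫ cokernelToX K n) hzero
    refine ⟨ψ, ?_⟩
    rw [← cancel_mono (cokernelToX K n), Category.assoc, π_cokernelToX, hψ]
  · rintro ⟨Y, ⟨e⟩, hY⟩
    obtain ⟨X, rfl⟩ : ∃ X : ℤ → C, Y = fun n => X (n + 1) :=
      ⟨fun n => Y (n - 1), by ext n; simp⟩
    have hX : ∀ n, InjectiveStep (X (n + 1)) (X n) := fun n => by
      simpa using hY (n - 1)
    obtain ⟨K, i, p, w, h, hd, hR⟩ := exists_splice X _ hX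
    obtain ⟨e'⟩ := nonempty_kernel_iso_of_splice h hd (neg_add_cancel 1)
    refine ⟨K, ⟨fun n => (hR n).1, acyclic_of_splice h hd, ?_⟩, ⟨e ≪≫ e'.symm⟩⟩
    intro J hJ n f hf
    generalize hm : n - 1 = m at hf
    obtain rfl : n = m + 1 := by omega
    rw [hd] at hf
    have : Mono (i m) := (h m).mono_f
    have hf' : f ≫ p (m + 1) = 0 := by
      rw [← cancel_mono (i m), Category.assoc, hf, zero_comp]
    obtain ⟨g, hg⟩ := (h (m + 1)).exists_lift f hf'
    obtain ⟨ψ, hψ⟩ := (hR (m + 1 + 1)).2 J hJ g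
    refine ⟨ψ, ?_⟩
    rw [hd, reassoc_of% hψ, hg]

lemma isGorensteinInjective_iff_op (M : C) :
    IsGorensteinInjective M ↔ IsGorensteinProjective (Opposite.op M) := by
  rw [isGorensteinInjective_iff, isGorensteinProjective_iff]
  constructor
  · rintro ⟨X, ⟨e⟩, h⟩
    refine ⟨fun n => Opposite.op (X (-n)), ⟨e.symm.op⟩, fun n => ?_⟩
    have := (h (-(n + 1))).op
    rwa [show -(n + 1) + 1 = -n by ring] at this
  · rintro ⟨X, ⟨e⟩, h⟩
    refine ⟨fun n => (X (-n)).unop, ⟨e.symm.unop⟩, fun n => ?_⟩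
    have := (h (-(n + 1))).unop
    rwa [show -(n + 1) + 1 = -n by ring] at this

lemma IsGorensteinProjective.of_iso {M N : C} (e : M ≅ N) (h : IsGorensteinProjective M) :
    IsGorensteinProjective N := by
  obtain ⟨P, hP, ⟨e'⟩⟩ := h
  exact ⟨P, hP, ⟨e.symm ≪≫ e'⟩⟩

lemma IsGorensteinProjective.of_isZero {M : C} (h : IsZero M) : IsGorensteinProjective M := by
  rw [isGorensteinProjective_iff]
  refine ⟨fun _ => M, ⟨Iso.refl _⟩, fun _ => ⟨M, 𝟙 M, 0, by simp, ?_, ?_, ?_⟩⟩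
  · exact ShortComplex.ShortExact.mk' (ShortComplex.exact_of_isZero_X₂ _ h)
      (inferInstanceAs (Mono (𝟙 M))) ⟨fun _ _ _ => h.eq_of_src _ _⟩
  · exact ⟨fun _ _ _ => ⟨0, h.eq_of_src _ _⟩⟩
  · exact fun Q _ φ => ⟨φ, by simp⟩

lemma ProjectiveStep.of_iso {X X' Y : C} (e : X ≅ X')
    (h : ProjectiveStep X Y) : ProjectiveStep X' Y := by
  obtain ⟨P, f, g, w, h, hP, H⟩ := h
  refine ⟨P, e.inv ≫ f, g, by rw [Category.assoc, w, comp_zero], ?_, hP, fun Q hQ φ => ?_⟩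
  · have := h.mono_f
    exact ShortComplex.ShortExact.mk' ((exact_epi_comp w e.inv rfl _).2 h.exact)
      (mono_comp e.inv f) h.epi_g
  · obtain ⟨ψ, hψ⟩ := H Q hQ (e.hom ≫ φ)
    exact ⟨ψ, by rw [Category.assoc, hψ, e.inv_hom_id_assoc]⟩

lemma IsGorensteinProjective.exists_projectiveStep {M : C} (hM : IsGorensteinProjective M) :
    ∃ N, ProjectiveStep M N ∧ IsGorensteinProjective N := by
  obtain ⟨X, ⟨e⟩, hX⟩ := (isGorensteinProjective_iff M).1 hM
  refine ⟨X (-1), .of_iso e.symm (by simpa using hX (-1)), ?_⟩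
  refine (isGorensteinProjective_iff _).2 ⟨fun n => X (n - 1), ⟨Iso.refl _⟩, fun n => ?_⟩
  have := hX (n - 1)
  rwa [show n - 1 + 1 = n + 1 - 1 by ring] at this

end GorensteinSequences

/-! ### Finite Gorenstein projective dimension -/

section Resolutions

variable {C : Type*} [Category C] [Abelian C]

/-- The Gorenstein projective dimension of an object is `< n`, by recursion on `n`: only zero
objects have dimension `< 0`, and dimension `< n + 1` means that the object is the quotient of a
Gorenstein projective object by an object of dimension `< n`. -/
def GorensteinProjectiveDimensionLT : ℕ → C → Prop
  | 0, X => IsZero X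
  | n + 1, X => ∃ (K G : C) (f : K ⟶ G) (g : G ⟶ X) (w : f ≫ g = 0),
      (ShortComplex.mk f g w).ShortExact ∧ IsGorensteinProjective G ∧
        GorensteinProjectiveDimensionLT n K

/-- The kernel of `ε` is resolved by the complex `G` with its term in degree `0` removed. -/
lemma GorensteinProjectiveDimensionLT.of_resolution (n : ℕ) : ∀ {M : C} (G : ChainComplex C ℕ)
    (ε : G.X 0 ⟶ M) (h : G.d 1 0 ≫ ε = 0), (∀ i, IsGorensteinProjective (G.X i)) →
    (∀ i, n ≤ i → IsZero (G.X i)) → (∀ i, G.ExactAt (i + 1)) →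
    (ShortComplex.mk (G.d 1 0) ε h).Exact → Epi ε → GorensteinProjectiveDimensionLT n M := by
  induction n with
  | zero =>
    intro M G ε h hG hz hex hex₀ hε
    exact IsZero.of_epi ε (hz 0 le_rfl)
  | succ n ih =>
    intro M G ε h hG hz hex hex₀ hε
    refine ⟨kernel ε, G.X 0, kernel.ι ε, ε, by simp,
      ShortComplex.ShortExact.mk' (ShortComplex.exact_kernel ε)
        (equalizer.ι_mono (f := ε) (g := 0)) hε, hG 0, ?_⟩
    have h10 : G.d (1 + 1) 1 ≫ kernel.lift ε (G.d 1 0) h = 0 := by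
      rw [← cancel_mono (kernel.ι ε)]
      simp
    refine ih (ChainComplex.truncate.obj G) (kernel.lift ε (G.d 1 0) h) h10
      (fun i => hG (i + 1)) (fun i hi => hz (i + 1) (by omega)) (fun i => ?_) ?_ ?_
    · exact (ChainComplex.exactAt_nat_iff _ _).2
        ((ChainComplex.exactAt_nat_iff G (i + 1)).1 (hex (i + 1)))
    · exact (exact_comp_mono h10 (kernel.ι ε) (kernel.lift_ι _ _ _).symm _).1
        ((ChainComplex.exactAt_nat_iff _ _).1 (hex 0))
    · exact hex₀.epi_kernelLift

/-- The converse of `GorensteinProjectiveDimensionLT.of_resolution`: a resolution of the kernel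
`K` is extended by one term to a resolution of `M`. -/
lemma GorensteinProjectiveDimensionLT.exists_resolution (n : ℕ) : ∀ {M : C},
    GorensteinProjectiveDimensionLT n M →
    ∃ (G : ChainComplex C ℕ) (ε : G.X 0 ⟶ M) (h : G.d 1 0 ≫ ε = 0),
      (∀ i, IsGorensteinProjective (G.X i)) ∧ (∀ i, n ≤ i → IsZero (G.X i)) ∧
      (∀ i, G.ExactAt (i + 1)) ∧ (ShortComplex.mk (G.d 1 0) ε h).Exact ∧ Epi ε := by
  induction n with
  | zero =>
    intro M hM
    replace hM : IsZero M := hM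
    let G : ChainComplex C ℕ := { X := fun _ => M, d := fun _ _ => 0 }
    refine ⟨G, 𝟙 M, by simp [G], fun _ => .of_isZero hM, fun _ _ => hM, fun i => ?_, ?_, ?_⟩
    · exact HomologicalComplex.ExactAt.of_isZero hM
    · exact ShortComplex.exact_of_isZero_X₂ _ hM
    · exact inferInstanceAs (Epi (𝟙 M))
  | succ n ih =>
    rintro M ⟨K, G₀, f, g, w, hS, hG₀, hK⟩
    obtain ⟨G, ε, h, hG, hz, hex, hex₀, hε⟩ := ih hK
    have : Mono f := hS.mono_f
    have h' : G.d 1 0 ≫ ε ≫ f = 0 := by rw [reassoc_of% h, zero_comp]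
    have w' : (ε ≫ f) ≫ g = 0 := by rw [Category.assoc, w, comp_zero]
    refine ⟨G.augment (ε ≫ f) h', g, w', ?_, ?_, ?_, ?_, hS.epi_g⟩
    · rintro (_ | i)
      exacts [hG₀, hG i]
    · rintro (_ | i) hi
      exacts [by omega, hz i (by omega)]
    · rintro (_ | i)
      · exact (ChainComplex.exactAt_nat_iff _ _).2 ((exact_comp_mono h f rfl h').2 hex₀)
      · exact (ChainComplex.exactAt_nat_iff _ _).2 ((ChainComplex.exactAt_nat_iff G i).1 (hex i))
    · exact (exact_epi_comp w ε rfl w').2 hS.exact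

lemma hasGorensteinProjectiveResolution_iff (M : C) (n : ℕ) :
    HasGorensteinProjectiveResolution M n ↔ GorensteinProjectiveDimensionLT (n + 1) M := by
  constructor
  · rintro ⟨G, ε, h, hG, hz, hex, hex₀, hε⟩
    exact .of_resolution (n + 1) G ε h hG (fun i hi => hz i hi) hex hex₀ hε
  · intro h
    obtain ⟨G, ε, h, hG, hz, hex, hex₀, hε⟩ := h.exists_resolution
    exact ⟨G, ε, h, hG, fun i hi => hz i hi, hex, hex₀, hε⟩

lemma hasGorensteinInjectiveResolution_iff_op (M : C) (n : ℕ) :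
    HasGorensteinInjectiveResolution M n ↔
      HasGorensteinProjectiveResolution (Opposite.op M) n := by
  constructor
  · rintro ⟨E, η, h, hE, hz, hex, hex₀, hη⟩
    refine ⟨E.op, η.op, congrArg Quiver.Hom.op h,
      fun i => (isGorensteinInjective_iff_op _).1 (hE i),
      fun i hi => (hz i hi).op, fun i => (hex i).op, hex₀.op, op_epi_of_mono η⟩
  · rintro ⟨G, ε, h, hG, hz, hex, hex₀, hε⟩
    refine ⟨HomologicalComplex.unop G, ε.unop, congrArg Quiver.Hom.unop h,
      fun i => (isGorensteinInjective_iff_op _).2 (hG i),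
      fun i hi => (hz i hi).unop, fun i => (hex i).unop, hex₀.unop, unop_mono_of_epi ε⟩

lemma gorensteinInjectiveDimension_eq_op (M : C) :
    gorensteinInjectiveDimension M = gorensteinProjectiveDimension (Opposite.op M) := by
  simp only [gorensteinInjectiveDimension, gorensteinProjectiveDimension,
    hasGorensteinInjectiveResolution_iff_op]

lemma GorensteinProjectiveDimensionLT.of_isZero (n : ℕ) {X : C} (hX : IsZero X) :
    GorensteinProjectiveDimensionLT n X := by
  induction n with
  | zero => exact hX
  | succ n ih =>
    exact ⟨X, X, 𝟙 X, 0, comp_zero, shortExact_of_desc _ inferInstance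
      ⟨fun _ _ _ => hX.eq_of_src _ _⟩ fun t _ => ⟨0, hX.eq_of_src _ _⟩, .of_isZero hX, ih⟩

end Resolutions

/-! ### Pushouts and splittings of short exact sequences -/

section ShortExactConstructions

variable {C : Type*} [Category C] [Abelian C]

lemma shortExact_projective_π [EnoughProjectives C] (X : C) :
    (ShortComplex.mk (kernel.ι (Projective.π X)) (Projective.π X)
      (kernel.condition _)).ShortExact :=
  ShortComplex.ShortExact.mk' (ShortComplex.exact_kernel _)
    (equalizer.ι_mono (f := Projective.π X) (g := 0)) (Projective.π_epi X)

/-- In a pushout square the cokernels of parallel arrows agree. -/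
lemma shortExact_of_isPushout {X Y Z X' E : C} {f : X ⟶ Y} {g : Y ⟶ Z} {w : f ≫ g = 0}
    (h : (ShortComplex.mk f g w).ShortExact) {a : X ⟶ X'} {b : Y ⟶ E} {c : X' ⟶ E}
    (sq : IsPushout f a b c) :
    ∃ (q : E ⟶ Z) (w' : c ≫ q = 0), (ShortComplex.mk c q w').ShortExact := by
  have hf : Mono f := h.mono_f
  have hg : Epi g := h.epi_g
  have hb : b ≫ sq.desc g 0 (by rw [w, comp_zero]) = g := sq.inl_desc _ _ _
  have hc : c ≫ sq.desc g 0 (by rw [w, comp_zero]) = 0 := sq.inr_desc _ _ _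
  refine ⟨_, hc, shortExact_of_desc _ ?_ ?_ fun t ht => ?_⟩
  · exact (MorphismProperty.monomorphisms C).of_isPushout sq.flip hf
  · exact epi_of_epi_fac hb
  · obtain ⟨u, hu⟩ := h.exists_desc (b ≫ t) (by
      rw [reassoc_of% sq.w, ht, comp_zero])
    refine ⟨u, sq.hom_ext ?_ ?_⟩
    · rw [reassoc_of% hb, hu]
    · rw [reassoc_of% hc, zero_comp, ht]

/-- The quotient of `D` by `A ⊆ B ⊆ D` is the pushout of `D` along `B ⟶ B / A`. -/
lemma shortExact_comp_of_isPushout {A B B' D E : C} {a : A ⟶ B} {p : B ⟶ B'} {w : a ≫ p = 0}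
    (h : (ShortComplex.mk a p w).ShortExact) {j : B ⟶ D} [Mono j] {b : D ⟶ E} {c : B' ⟶ E}
    (sq : IsPushout j p b c) :
    ∃ w' : (a ≫ j) ≫ b = 0, (ShortComplex.mk (a ≫ j) b w').ShortExact := by
  have ha : Mono a := h.mono_f
  have hp : Epi p := h.epi_g
  refine ⟨by rw [Category.assoc, sq.w, reassoc_of% w, zero_comp],
    shortExact_of_desc _ (mono_comp a j) ?_ fun t ht => ?_⟩
  · exact (MorphismProperty.epimorphisms C).of_isPushout sq hp
  · obtain ⟨u, hu⟩ := h.exists_desc (j ≫ t) (by simpa using ht)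
    exact ⟨sq.desc t u hu.symm, sq.inl_desc _ _ _⟩

/-- A retraction `r` of `f` splits the exact sequence `0 ⟶ X ⟶ Y ⟶ Z ⟶ 0`, and turns it into an
exact sequence `0 ⟶ Z ⟶ Y ⟶ X ⟶ 0`. -/
lemma exists_shortExact_of_retraction {X Y Z : C} {f : X ⟶ Y} {g : Y ⟶ Z} {w : f ≫ g = 0}
    (h : (ShortComplex.mk f g w).ShortExact) (r : Y ⟶ X) (hr : f ≫ r = 𝟙 X) :
    ∃ (s : Z ⟶ Y) (w' : s ≫ r = 0), (ShortComplex.mk s r w').ShortExact := by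
  have hg := h.epi_g
  let σ := ShortComplex.Splitting.ofExactOfRetraction _ h.exact r hr hg
  have hs : σ.s ≫ g = 𝟙 Z := σ.s_g
  have hid : r ≫ f + g ≫ σ.s = 𝟙 Y := σ.id
  have hsr : σ.s ≫ r = 0 := σ.s_r
  refine ⟨σ.s, hsr, shortExact_of_desc _ (mono_of_mono_fac hs) (epi_of_epi_fac hr) fun t ht => ?_⟩
  refine ⟨f ≫ t, ?_⟩
  replace ht : σ.s ≫ t = 0 := ht
  calc r ≫ f ≫ t = (r ≫ f + g ≫ σ.s) ≫ t := by simp [Preadditive.add_comp, ht]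
    _ = t := by rw [hid, Category.id_comp]

/-- Let `0 ⟶ X ⟶ Y ⟶ Z ⟶ 0` be split exact, and `0 ⟶ Z ⟶ Q ⟶ Z' ⟶ 0` exact. Then there is an
exact sequence `0 ⟶ Y ⟶ X ⊞ Q ⟶ Z' ⟶ 0`. -/
lemma shortExact_biprod_of_retraction {X Y Z Q Z' : C} {f : X ⟶ Y} {g : Y ⟶ Z} {w : f ≫ g = 0}
    (h : (ShortComplex.mk f g w).ShortExact) (r : Y ⟶ X) (hr : f ≫ r = 𝟙 X)
    {j : Z ⟶ Q} {q : Q ⟶ Z'} {w' : j ≫ q = 0} (h' : (ShortComplex.mk j q w').ShortExact) :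
    ∃ w'' : biprod.lift r (g ≫ j) ≫ biprod.snd ≫ q = 0,
      (ShortComplex.mk (biprod.lift r (g ≫ j)) (biprod.snd ≫ q) w'').ShortExact := by
  have hg : Epi g := h.epi_g
  have hj : Mono j := h'.mono_f
  have hq : Epi q := h'.epi_g
  refine ⟨by simp [w'], shortExact_of_desc _ ?_ (epi_comp _ _) fun {T} t ht => ?_⟩
  · refine Preadditive.mono_of_cancel_zero _ fun {T} x hx => ?_
    have hx₁ : x ≫ r = 0 := by simpa using hx =≫ biprod.fst
    have hx₂ : x ≫ g = 0 := by
      rw [← cancel_mono j]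
      simpa using hx =≫ biprod.snd
    obtain ⟨y, rfl⟩ := h.exists_lift x hx₂
    rw [Category.assoc, hr, Category.comp_id] at hx₁
    rw [hx₁, zero_comp]
  · have h₁ : biprod.inl ≫ t = 0 := by
      have : f ≫ biprod.lift r (g ≫ j) = biprod.inl := by
        ext
        · simpa using hr
        · simp [reassoc_of% w]
      rw [← this, Category.assoc, ht, comp_zero]
    have h₂ : j ≫ biprod.inr ≫ t = 0 := by
      rw [biprod.lift_eq, Preadditive.add_comp] at ht
      rw [← cancel_epi g]
      simpa [h₁] using ht
    obtain ⟨u, hu⟩ := h'.exists_desc _ h₂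
    refine ⟨u, ?_⟩
    ext
    · simp [h₁]
    · simp [hu]

end ShortExactConstructions

/-! ### Vanishing of `Ext` into projective objects -/

section ExtVanishing

variable {C : Type*} [Category C] [Abelian C] [HasExt.{w} C]
open Abelian

/-- `Extⁱ(X, Q) = 0` for all projective `Q` and all `i ≥ n`. -/
def ExtProjectiveVanishesFrom (n : ℕ) (X : C) : Prop :=
  ∀ Q : C, Projective Q → ∀ i, n ≤ i → Subsingleton (Ext.{w} X Q i)

section

variable {X Y Z : C} {f : X ⟶ Y} {g : Y ⟶ Z} {w : f ≫ g = 0}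

lemma CategoryTheory.Abelian.Ext.subsingleton_left (h : (ShortComplex.mk f g w).ShortExact)
    (Q : C) (i : ℕ) (hY : Subsingleton (Ext.{w} Y Q i)) (hZ : Subsingleton (Ext.{w} Z Q (i + 1))) :
    Subsingleton (Ext.{w} X Q i) := by
  refine subsingleton_of_forall_eq 0 fun x => ?_
  obtain ⟨y, rfl⟩ := Ext.contravariant_sequence_exact₁ h Q x (add_comm 1 i)
    (Subsingleton.elim (α := Ext.{w} Z Q (i + 1)) _ _)
  rw [show y = 0 from Subsingleton.elim (α := Ext.{w} Y Q i) _ _, Ext.comp_zero]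

lemma CategoryTheory.Abelian.Ext.subsingleton_middle (h : (ShortComplex.mk f g w).ShortExact)
    (Q : C) (i : ℕ) (hX : Subsingleton (Ext.{w} X Q i)) (hZ : Subsingleton (Ext.{w} Z Q i)) :
    Subsingleton (Ext.{w} Y Q i) := by
  refine subsingleton_of_forall_eq 0 fun y => ?_
  obtain ⟨z, rfl⟩ := Ext.contravariant_sequence_exact₂ h Q y
    (Subsingleton.elim (α := Ext.{w} X Q i) _ _)
  rw [show z = 0 from Subsingleton.elim (α := Ext.{w} Z Q i) _ _, Ext.comp_zero]

lemma CategoryTheory.Abelian.Ext.subsingleton_right (h : (ShortComplex.mk f g w).ShortExact)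
    (Q : C) (i : ℕ) (hX : Subsingleton (Ext.{w} X Q i)) (hY : Subsingleton (Ext.{w} Y Q (i + 1))) :
    Subsingleton (Ext.{w} Z Q (i + 1)) := by
  refine subsingleton_of_forall_eq 0 fun z => ?_
  obtain ⟨x, rfl⟩ := Ext.contravariant_sequence_exact₃ h Q z
    (Subsingleton.elim (α := Ext.{w} Y Q (i + 1)) _ _) (add_comm 1 i)
  rw [show x = 0 from Subsingleton.elim (α := Ext.{w} X Q i) _ _, Ext.comp_zero]

lemma CategoryTheory.Abelian.Ext.exists_extension (h : (ShortComplex.mk f g w).ShortExact) {Q : C}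
    (hZ : Subsingleton (Ext.{w} Z Q 1)) (φ : X ⟶ Q) : ∃ ψ : Y ⟶ Q, f ≫ ψ = φ := by
  obtain ⟨y, hy⟩ := Ext.contravariant_sequence_exact₁ h Q (Ext.mk₀ φ) (add_zero 1)
    (Subsingleton.elim (α := Ext.{w} Z Q 1) _ _)
  obtain ⟨ψ, rfl⟩ := (Ext.mk₀_bijective Y Q).2 y
  refine ⟨ψ, (Ext.mk₀_bijective X Q).1 ?_⟩
  rw [← hy, Ext.mk₀_comp_mk₀]

lemma CategoryTheory.Abelian.Ext.subsingleton_one_of_extension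
    (h : (ShortComplex.mk f g w).ShortExact) {Q : C} (hY : Subsingleton (Ext.{w} Y Q 1))
    (H : ∀ φ : X ⟶ Q, ∃ ψ : Y ⟶ Q, f ≫ ψ = φ) : Subsingleton (Ext.{w} Z Q 1) := by
  refine subsingleton_of_forall_eq 0 fun z => ?_
  obtain ⟨x, rfl⟩ := Ext.contravariant_sequence_exact₃ h Q z
    (Subsingleton.elim (α := Ext.{w} Y Q 1) _ _) (add_zero 1)
  obtain ⟨φ, rfl⟩ := (Ext.mk₀_bijective X Q).2 x
  obtain ⟨ψ, rfl⟩ := H φ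
  rw [← Ext.mk₀_comp_mk₀]
  exact h.extClass_comp_assoc (Ext.mk₀ ψ)

namespace ExtProjectiveVanishesFrom

variable {n : ℕ}

lemma mono {m : ℕ} (h : ExtProjectiveVanishesFrom.{w} n X) (hm : n ≤ m) :
    ExtProjectiveVanishesFrom.{w} m X :=
  fun Q hQ i hi => h Q hQ i (hm.trans hi)

lemma of_projective [Projective X] : ExtProjectiveVanishesFrom.{w} 1 X := by
  intro Q _ i hi
  obtain ⟨j, rfl⟩ := Nat.exists_eq_add_of_le' hi
  exact Ext.subsingleton_of_projective X Q j

lemma left (h : (ShortComplex.mk f g w).ShortExact) (hY : ExtProjectiveVanishesFrom.{w} n Y)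
    (hZ : ExtProjectiveVanishesFrom.{w} (n + 1) Z) : ExtProjectiveVanishesFrom.{w} n X :=
  fun Q hQ i hi => Ext.subsingleton_left h Q i (hY Q hQ i hi) (hZ Q hQ (i + 1) (by omega))

lemma middle (h : (ShortComplex.mk f g w).ShortExact) (hX : ExtProjectiveVanishesFrom.{w} n X)
    (hZ : ExtProjectiveVanishesFrom.{w} n Z) : ExtProjectiveVanishesFrom.{w} n Y :=
  fun Q hQ i hi => Ext.subsingleton_middle h Q i (hX Q hQ i hi) (hZ Q hQ i hi)

lemma right (h : (ShortComplex.mk f g w).ShortExact) (hX : ExtProjectiveVanishesFrom.{w} n X)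
    (hY : ExtProjectiveVanishesFrom.{w} (n + 1) Y) :
    ExtProjectiveVanishesFrom.{w} (n + 1) Z := by
  intro Q hQ i hi
  obtain ⟨j, rfl⟩ : ∃ j, i = j + 1 := ⟨i - 1, by omega⟩
  exact Ext.subsingleton_right h Q j (hX Q hQ j (by omega)) (hY Q hQ (j + 1) hi)

end ExtProjectiveVanishesFrom

end

end ExtVanishing

/-! ### Closure properties of Gorenstein projective objects -/

section GorensteinProjectives

open scoped ZeroObject

variable {C : Type*} [Category C] [Abelian C] [HasExt.{w} C]
open Abelian

lemma IsGorensteinProjective.extProjectiveVanishesFrom {M : C} (hM : IsGorensteinProjective M) :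
    ExtProjectiveVanishesFrom.{w} 1 M := by
  obtain ⟨X, ⟨e⟩, hX⟩ := (isGorensteinProjective_iff M).1 hM
  have key (Q : C) (hQ : Projective Q) (i : ℕ) :
      ∀ n, Subsingleton (Ext.{w} (X n) Q (i + 1)) := by
    induction i with
    | zero =>
      intro n
      obtain ⟨P, f, g, w, h, hP, H⟩ := hX n
      exact Ext.subsingleton_one_of_extension h (Ext.subsingleton_of_projective P Q 0) (H Q hQ)
    | succ i ih =>
      intro n
      obtain ⟨P, f, g, w, h, hP, -⟩ := hX n
      exact Ext.subsingleton_right h Q (i + 1) (ih (n + 1))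
        (Ext.subsingleton_of_projective P Q (i + 1))
  intro Q hQ i hi
  obtain ⟨j, rfl⟩ := Nat.exists_eq_add_of_le' hi
  have := key Q hQ j 0
  refine subsingleton_of_forall_eq 0 fun x => ?_
  rw [← Ext.mk₀_id_comp x, ← e.hom_inv_id, ← Ext.mk₀_comp_mk₀_assoc,
    Subsingleton.elim ((Ext.mk₀ e.inv).comp x (zero_add _)) 0, Ext.comp_zero]

/-- Coinduction for Gorenstein projective objects: if no object of the class `S` has higher `Ext`
into projectives, and each embeds into a projective with cokernel again in `S`, then all objects of
`S` are Gorenstein projective. The half of the complex to the left comes from epimorphisms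
`Projective.π` from projectives, whose kernels inherit the vanishing of `Ext`. -/
lemma isGorensteinProjective_of_coinduction [EnoughProjectives C] (S : C → Prop)
    (hExt : ∀ X, S X → ExtProjectiveVanishesFrom.{w} 1 X)
    (hStep : ∀ X, S X → ∃ (P Y : C) (f : X ⟶ P) (g : P ⟶ Y) (w : f ≫ g = 0),
      (ShortComplex.mk f g w).ShortExact ∧ Projective P ∧ S Y) {M : C} (hM : S M) :
    IsGorensteinProjective M := by
  have hS : ∀ X : Subtype S, ∃ Y : Subtype S, ProjectiveStep X.1 Y.1 := by
    rintro ⟨X, hX⟩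
    obtain ⟨P, Y, f, g, w, h, hP, hY⟩ := hStep X hX
    exact ⟨⟨Y, hY⟩, P, f, g, w, h, hP, fun Q hQ φ =>
      Ext.exists_extension h (hExt Y hY Q hQ 1 le_rfl) φ⟩
  have hT : ∀ Y : { Y : C // ExtProjectiveVanishesFrom.{w} 1 Y },
      ∃ X : { X : C // ExtProjectiveVanishesFrom.{w} 1 X }, ProjectiveStep X.1 Y.1 := by
    rintro ⟨Y, hY⟩
    have h := shortExact_projective_π Y
    exact ⟨⟨_, .left h .of_projective (hY.mono one_le_two)⟩, _, _, _, _, h, inferInstance,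
      fun Q hQ φ => Ext.exists_extension h (hY Q hQ 1 le_rfl) φ⟩
  choose s hs using hS
  choose t ht using hT
  -- `t` adds terms on the left, in nonnegative degrees, and `s` terms on the right of `M`.
  let X : ℤ → C
    | .ofNat n => (t^[n] ⟨M, hExt M hM⟩).1
    | .negSucc n => (s^[n + 1] ⟨M, hM⟩).1
  refine (isGorensteinProjective_iff M).2 ⟨X, ⟨Iso.refl _⟩, ?_⟩
  rintro (n | _ | n)
  · change ProjectiveStep (t^[n + 1] ⟨M, hExt M hM⟩).1 (t^[n] ⟨M, hExt M hM⟩).1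
    rw [Function.iterate_succ_apply']
    exact ht _
  · exact hs ⟨M, hM⟩
  · change ProjectiveStep (s^[n + 1] ⟨M, hM⟩).1 (s^[n + 1 + 1] ⟨M, hM⟩).1
    rw [Function.iterate_succ_apply' _ (n + 1)]
    exact hs _

lemma GorensteinProjectiveDimensionLT.extProjectiveVanishesFrom {n : ℕ} : ∀ {X : C},
    GorensteinProjectiveDimensionLT n X → ExtProjectiveVanishesFrom.{w} n X := by
  induction n with
  | zero =>
    intro X hX Q hQ i _
    have hX : IsZero X := hX
    refine subsingleton_of_forall_eq 0 fun x => ?_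
    rw [← Ext.mk₀_id_comp x, hX.eq_of_src (𝟙 X) 0, Ext.mk₀_zero, Ext.zero_comp]
  | succ n ih =>
    rintro X ⟨K, G, f, g, w, h, hG, hK⟩
    exact .right h (ih hK) (hG.extProjectiveVanishesFrom.mono (by omega))

variable [EnoughProjectives C]

lemma IsGorensteinProjective.of_projective (P : C) [hP : Projective P] :
    IsGorensteinProjective P := by
  refine isGorensteinProjective_of_coinduction.{w} (fun X => Projective X)
    (fun X hX => .of_projective) (fun X hX => ?_) hP
  refine ⟨X, 0, 𝟙 X, 0, comp_zero, ?_, hX, inferInstance⟩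
  exact shortExact_of_desc _ inferInstance ⟨fun _ _ _ => (isZero_zero C).eq_of_src _ _⟩
    fun t ht => ⟨0, by simpa using ht.symm⟩

lemma isGorensteinProjective_of_shortExact {X P Y : C} {f : X ⟶ P} {g : P ⟶ Y} {w : f ≫ g = 0}
    (h : (ShortComplex.mk f g w).ShortExact) (hX : ExtProjectiveVanishesFrom.{w} 1 X)
    (hP : Projective P) (hY : IsGorensteinProjective Y) : IsGorensteinProjective X := by
  refine isGorensteinProjective_of_coinduction.{w}
    (fun Z => IsGorensteinProjective Z ∨ Z = X) ?_ ?_ (Or.inr rfl)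
  · rintro Z (hZ | rfl)
    exacts [hZ.extProjectiveVanishesFrom, hX]
  · rintro Z (hZ | rfl)
    · obtain ⟨N, ⟨P, f, g, w, h, hP, -⟩, hN⟩ := hZ.exists_projectiveStep
      exact ⟨P, N, f, g, w, h, hP, Or.inl hN⟩
    · exact ⟨P, Y, f, g, w, h, hP, Or.inl hY⟩

/-- Extensions of Gorenstein projective objects satisfy the hypotheses of coinduction. With
`X ⟶ P` and `Z ⟶ Q` the embeddings of the outer terms into projectives, `Y` embeds into `P ⊞ Q`
with cokernel an extension of `Q / Z` by `P / X`. -/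
lemma IsGorensteinProjective.of_extension {X Y Z : C} {f : X ⟶ Y} {g : Y ⟶ Z} {w : f ≫ g = 0}
    (h : (ShortComplex.mk f g w).ShortExact) (hX : IsGorensteinProjective X)
    (hZ : IsGorensteinProjective Z) : IsGorensteinProjective Y := by
  refine isGorensteinProjective_of_coinduction.{w}
    (fun Y => ∃ (X Z : C) (f : X ⟶ Y) (g : Y ⟶ Z) (w : f ≫ g = 0),
      (ShortComplex.mk f g w).ShortExact ∧ IsGorensteinProjective X ∧ IsGorensteinProjective Z)
    ?_ ?_ ⟨X, Z, f, g, w, h, hX, hZ⟩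
  · rintro Y ⟨X, Z, f, g, w, h, hX, hZ⟩
    exact .middle h hX.extProjectiveVanishesFrom hZ.extProjectiveVanishesFrom
  · rintro Y ⟨X, Z, f, g, w, h, hX, hZ⟩
    obtain ⟨X', ⟨P, i, p, wX, hXP, hP, -⟩, hX'⟩ := hX.exists_projectiveStep
    obtain ⟨Z', ⟨Q, j, q, wZ, hZQ, hQ, -⟩, hZ'⟩ := hZ.exists_projectiveStep
    -- The pushout of `Y` along `X ⟶ P` is a split extension of `Z` by `P`, as `Ext¹(Z, P) = 0`.
    have sq := IsPushout.of_hasPushout f i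
    obtain ⟨v, w₁, h₁⟩ := shortExact_of_isPushout h sq
    obtain ⟨v', w₂, h₂⟩ := shortExact_of_isPushout hXP sq.flip
    obtain ⟨r, hr⟩ := Ext.exists_extension h₁
      (hZ.extProjectiveVanishesFrom P hP 1 le_rfl) (𝟙 P)
    obtain ⟨w₃, h₃⟩ := shortExact_biprod_of_retraction h₁ r hr hZQ
    -- `Y ⊆ pushout ⊆ P ⊞ Q`, with subquotients `X' = P / X` and `Z' = Q / Z`.
    have := h₃.mono_f
    have sq' := IsPushout.of_hasPushout (biprod.lift r (v ≫ j)) v'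
    obtain ⟨w₄, h₄⟩ := shortExact_comp_of_isPushout h₂ sq'
    obtain ⟨v'', w₅, h₅⟩ := shortExact_of_isPushout h₃ sq'
    exact ⟨_, _, _, _, w₄, h₄, inferInstance, _, _, _, _, w₅, h₅, hX', hZ'⟩

/-- If `0 ⟶ K' ⟶ G ⟶ K ⟶ 0` is exact with `K'` and `G` Gorenstein projective, then so is `K`,
provided that `K` has no higher `Ext` into projectives. For a suitable projective `P` the pushout of
`G` along `K' ⟶ P` is on the one hand an extension of Gorenstein projectives, and on the other hand
isomorphic to `P ⊞ K`. -/
lemma IsGorensteinProjective.of_quotient {K' G K : C} {f : K' ⟶ G} {g : G ⟶ K} {w : f ≫ g = 0}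
    (h : (ShortComplex.mk f g w).ShortExact) (hK' : IsGorensteinProjective K')
    (hG : IsGorensteinProjective G) (hK : ExtProjectiveVanishesFrom.{w} 1 K) :
    IsGorensteinProjective K := by
  obtain ⟨L, ⟨P, i, p, wL, hL, hP, -⟩, hLG⟩ := hK'.exists_projectiveStep
  have sq := IsPushout.of_hasPushout f i
  obtain ⟨q, w₁, h₁⟩ := shortExact_of_isPushout h sq
  obtain ⟨q', w₂, h₂⟩ := shortExact_of_isPushout hL sq.flip
  have hE : IsGorensteinProjective (pushout f i) := .of_extension.{w} h₂ hG hLG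
  obtain ⟨r, hr⟩ := Ext.exists_extension h₁ (hK P hP 1 le_rfl) (𝟙 P)
  -- Embed `K` into a projective `P₀` through the pushout `E`; the cokernel is an extension of
  -- `P₀ / E` by `E / K = P`.
  obtain ⟨s, w₃, h₃⟩ := exists_shortExact_of_retraction h₁ r hr
  obtain ⟨N, ⟨P₀, j, p₀, wN, hN, hP₀, -⟩, hNG⟩ := hE.exists_projectiveStep
  have : Mono j := hN.mono_f
  have sq' := IsPushout.of_hasPushout j r
  obtain ⟨w₄, h₄⟩ := shortExact_comp_of_isPushout h₃ sq'
  obtain ⟨v, w₅, h₅⟩ := shortExact_of_isPushout hN sq'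
  exact isGorensteinProjective_of_shortExact.{w} h₄ hK hP₀
    (.of_extension.{w} h₅ (.of_projective.{w} P) hNG)

/-- Once the Gorenstein projective dimension is known to be finite, it is determined by the
vanishing of `Ext` into projective objects. -/
lemma GorensteinProjectiveDimensionLT.of_extProjectiveVanishesFrom {n : ℕ} : ∀ {m : ℕ} {X : C},
    GorensteinProjectiveDimensionLT n X → ExtProjectiveVanishesFrom.{w} (m + 1) X →
    GorensteinProjectiveDimensionLT (m + 1) X := by
  have base {X : C} (hX : IsGorensteinProjective X) : GorensteinProjectiveDimensionLT 1 X :=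
    ⟨0, X, 0, 𝟙 X, zero_comp, shortExact_of_desc _ ⟨fun _ _ _ => (isZero_zero C).eq_of_tgt _ _⟩
      inferInstance fun t _ => ⟨t, Category.id_comp t⟩, hX, isZero_zero C⟩
  have top {X : C} (hX : GorensteinProjectiveDimensionLT 1 X) : IsGorensteinProjective X := by
    obtain ⟨K, G, f, g, w, h, hG, hK⟩ := hX
    have : IsIso g := h.isIso_g_iff.2 hK
    exact hG.of_iso (asIso g)
  induction n with
  | zero =>
    intro m X hX _
    have hX : IsZero X := hX
    exact .of_isZero (m + 1) hX
  | succ n ih =>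
    rintro (_ | m) X ⟨K, G, f, g, w, h, hG, hK⟩ hX
    -- For `m = 0` the kernel `K` is Gorenstein projective by induction.
    · have hK' := top (ih hK (.left h hG.extProjectiveVanishesFrom (hX.mono (by omega))))
      exact base (.of_quotient.{w} h hK' hG hX)
    · exact ⟨K, G, f, g, w, h, hG, ih hK
        (.left h (hG.extProjectiveVanishesFrom.mono (by omega)) hX)⟩

end GorensteinProjectives

/-! ### Functors with isomorphic left and right adjoints -/

section FrobeniusFunctors

universe w' v v' u u'

open Abelian

variable {C : Type u} {D : Type u'} [Category.{v} C] [Category.{v'} D] [Abelian C] [Abelian D]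
  {F : C ⥤ D} {G : D ⥤ C} (adj₁ : F ⊣ G) (adj₂ : G ⊣ F)

include adj₁ adj₂

lemma CategoryTheory.ShortComplex.ShortExact.map_of_adjunctions {X Y Z : C} {f : X ⟶ Y} {g : Y ⟶ Z}
    {w : f ≫ g = 0} (h : (ShortComplex.mk f g w).ShortExact) :
    ∃ w' : F.map f ≫ F.map g = 0, (ShortComplex.mk (F.map f) (F.map g) w').ShortExact := by
  have := adj₁.isLeftAdjoint
  have := adj₂.isRightAdjoint
  have := adj₁.leftAdjoint_preservesColimits
  have := adj₂.rightAdjoint_preservesLimits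
  exact ⟨_, h.map_of_exact F⟩

omit [Abelian C] [Abelian D] in
lemma projective_map_of_adjunctions {P : C} (hP : Projective P) : Projective (F.obj P) := by
  have := adj₂.isLeftAdjoint
  exact adj₁.map_projective P hP

lemma ProjectiveStep.map {X Y : C} (h : ProjectiveStep X Y) :
    ProjectiveStep (F.obj X) (F.obj Y) := by
  obtain ⟨P, f, g, w, h, hP, H⟩ := h
  obtain ⟨w', h'⟩ := h.map_of_adjunctions adj₁ adj₂
  refine ⟨F.obj P, F.map f, F.map g, w', h', projective_map_of_adjunctions adj₁ adj₂ hP,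
    fun Q hQ φ => ?_⟩
  obtain ⟨ψ, hψ⟩ := H (G.obj Q) (projective_map_of_adjunctions adj₂ adj₁ hQ)
    (adj₁.homEquiv _ _ φ)
  refine ⟨(adj₁.homEquiv _ _).symm ψ, ?_⟩
  rw [← adj₁.homEquiv_naturality_left_symm, hψ, Equiv.symm_apply_apply]

lemma IsGorensteinProjective.map {X : C} (h : IsGorensteinProjective X) :
    IsGorensteinProjective (F.obj X) := by
  obtain ⟨Y, ⟨e⟩, hY⟩ := (isGorensteinProjective_iff X).1 h
  exact (isGorensteinProjective_iff _).2
    ⟨fun n => F.obj (Y n), ⟨F.mapIso e⟩, fun n => (hY n).map adj₁ adj₂⟩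

lemma GorensteinProjectiveDimensionLT.map {n : ℕ} : ∀ {X : C},
    GorensteinProjectiveDimensionLT n X → GorensteinProjectiveDimensionLT n (F.obj X) := by
  induction n with
  | zero =>
    intro X hX
    have := adj₁.isLeftAdjoint
    exact F.map_isZero hX
  | succ n ih =>
    rintro X ⟨K, L, f, g, w, h, hL, hK⟩
    obtain ⟨w', h'⟩ := h.map_of_adjunctions adj₁ adj₂
    exact ⟨_, _, _, _, w', h', hL.map adj₁ adj₂, ih hK⟩

/-- The adjunction isomorphism `Extⁱ(F X, N) ≅ Extⁱ(X, G N)`, in the form of a transfer of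
vanishing, by dimension shifting. -/
lemma CategoryTheory.Abelian.Ext.subsingleton_of_adjunctions [HasExt.{w} C] [HasExt.{w'} D]
    [EnoughProjectives C] (N : D) (i : ℕ) : ∀ {X : C},
      Subsingleton (Ext.{w'} (F.obj X) N (i + 1)) →
      Subsingleton (Ext.{w} X (G.obj N) (i + 1)) := by
  induction i with
  | zero =>
    intro X hX
    have h := shortExact_projective_π X
    obtain ⟨w', h'⟩ := h.map_of_adjunctions adj₁ adj₂
    refine Ext.subsingleton_one_of_extension h (Ext.subsingleton_of_projective _ _ 0) fun φ => ?_
    obtain ⟨ψ, hψ⟩ := Ext.exists_extension h' hX ((adj₁.homEquiv _ _).symm φ)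
    refine ⟨adj₁.homEquiv _ _ ψ, ?_⟩
    rw [← adj₁.homEquiv_naturality_left, hψ, Equiv.apply_symm_apply]
  | succ i ih =>
    intro X hX
    have h := shortExact_projective_π X
    obtain ⟨w', h'⟩ := h.map_of_adjunctions adj₁ adj₂
    have := projective_map_of_adjunctions adj₁ adj₂ (P := Projective.over X) inferInstance
    exact Ext.subsingleton_right h _ (i + 1)
      (ih (Ext.subsingleton_left h' N (i + 1) (Ext.subsingleton_of_projective _ _ i) hX))
      (Ext.subsingleton_of_projective _ _ (i + 1))

lemma ExtProjectiveVanishesFrom.of_map [HasExt.{w} C] [HasExt.{w'} D] [EnoughProjectives C]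
    [F.Faithful] {n : ℕ} {X : C} (h : ExtProjectiveVanishesFrom.{w'} (n + 1) (F.obj X)) :
    ExtProjectiveVanishesFrom.{w} (n + 1) X := by
  intro Q hQ i hi
  obtain ⟨j, rfl⟩ : ∃ j, i = j + 1 := ⟨i - 1, by omega⟩
  have hQ' := projective_map_of_adjunctions adj₁ adj₂ hQ
  have : Subsingleton (Ext.{w} X ((F ⋙ G).obj Q) (j + 1)) :=
    Ext.subsingleton_of_adjunctions.{w} adj₁ adj₂ (F.obj Q) j (h _ hQ' (j + 1) hi)
  -- As `F` is faithful, the counit is an epimorphism, so that `Q` is a summand of `G (F Q)`.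
  have hs : Projective.factorThru (𝟙 Q) (adj₂.counit.app Q) ≫ adj₂.counit.app Q = 𝟙 Q :=
    Projective.factorThru_comp _ _
  refine subsingleton_of_forall_eq 0 fun x => ?_
  rw [← Ext.comp_mk₀_id x, ← hs, ← Ext.mk₀_comp_mk₀, ← Ext.comp_assoc_of_third_deg_zero,
    Subsingleton.elim (x.comp (Ext.mk₀ (Projective.factorThru (𝟙 Q) (adj₂.counit.app Q)))
      (add_zero _)) 0, Ext.zero_comp]

/-- A faithful functor which has the same functor as left and as right adjoint preserves
finite Gorenstein projective dimensions. -/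
lemma gorensteinProjectiveDimension_eq_of_adjunctions [EnoughProjectives C]
    [EnoughProjectives D] [F.Faithful] {M : C} (hM : gorensteinProjectiveDimension M < ⊤) :
    gorensteinProjectiveDimension M = gorensteinProjectiveDimension (F.obj M) := by
  have := hasExt_of_enoughProjectives.{v} C
  have := hasExt_of_enoughProjectives.{v'} D
  obtain ⟨n, hn⟩ : ∃ n, HasGorensteinProjectiveResolution M n := by
    by_contra! H
    simp [gorensteinProjectiveDimension, H] at hM
  have key (m : ℕ) : HasGorensteinProjectiveResolution M m ↔
      HasGorensteinProjectiveResolution (F.obj M) m := by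
    rw [hasGorensteinProjectiveResolution_iff] at hn
    rw [hasGorensteinProjectiveResolution_iff, hasGorensteinProjectiveResolution_iff]
    exact ⟨fun h => h.map adj₁ adj₂, fun h => hn.of_extProjectiveVanishesFrom
      (h.extProjectiveVanishesFrom.of_map adj₁ adj₂)⟩
  simp only [gorensteinProjectiveDimension, key]

lemma gorensteinInjectiveDimension_eq_of_adjunctions [EnoughInjectives C]
    [EnoughInjectives D] [F.Faithful] {M : C} (hM : gorensteinInjectiveDimension M < ⊤) :
    gorensteinInjectiveDimension M = gorensteinInjectiveDimension (F.obj M) := by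
  rw [gorensteinInjectiveDimension_eq_op] at hM ⊢
  rw [gorensteinInjectiveDimension_eq_op]
  exact gorensteinProjectiveDimension_eq_of_adjunctions adj₂.op adj₁.op hM

end FrobeniusFunctors

/-! ### The adjunction of a Frobenius extension -/

section FrobeniusExtensions

variable {R : Type u₁} {A : Type u₂} [Ring R] [Ring A] {ι : R →+* A}

/-- The additive map `A → N` underlying an element of the coextension of scalars of `N`. -/
noncomputable def coextendEval {N : ModuleCat.{max u₁ u₂ w} R}
    (φ : (ModuleCat.coextendScalars ι).obj N) : A →+ N :=
  (ModuleCat.CoextendScalars.equiv ι N φ).toAddMonoidHom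

/-- The element of the coextension of scalars of `N` given by an additive map `A → N` which is
compatible with the scalars from `R`. -/
noncomputable def coextendMk {N : ModuleCat.{max u₁ u₂ w} R} (φ : A →+ N)
    (h : ∀ (r : R) (a : A), φ (ι r * a) = r • φ a) : (ModuleCat.coextendScalars ι).obj N :=
  (ModuleCat.CoextendScalars.equiv ι N).symm
    { toFun := φ
      map_add' := φ.map_add
      map_smul' := h }

section

variable {N : ModuleCat.{max u₁ u₂ w} R}

lemma coextendEval_ext {φ ψ : (ModuleCat.coextendScalars ι).obj N}
    (h : ∀ a, coextendEval φ a = coextendEval ψ a) : φ = ψ :=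
  ModuleCat.CoextendScalars.ext (LinearMap.ext h)

lemma coextendEval_add (φ ψ : (ModuleCat.coextendScalars ι).obj N) (a : A) :
    coextendEval (φ + ψ) a = coextendEval φ a + coextendEval ψ a := rfl

lemma coextendEval_sum {κ : Type*} (t : Finset κ)
    (φ : κ → (ModuleCat.coextendScalars ι).obj N) (a : A) :
    coextendEval (∑ i ∈ t, φ i) a = ∑ i ∈ t, coextendEval (φ i) a :=
  map_sum (AddMonoidHom.mk' (fun φ : (ModuleCat.coextendScalars ι).obj N => coextendEval φ a)
    fun φ ψ => coextendEval_add φ ψ a) φ t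

lemma coextendEval_mul (φ : (ModuleCat.coextendScalars ι).obj N) (r : R) (a : A) :
    coextendEval φ (ι r * a) = r • coextendEval φ a :=
  (ModuleCat.CoextendScalars.equiv ι N φ).map_smul r a

end

section

variable {τ : A →+ R} {k : ℕ} {x y : Fin k → A}
  (hτl : ∀ (r : R) (a : A), τ (ι r * a) = r * τ a)
  (hτr : ∀ (a : A) (r : R), τ (a * ι r) = τ a * r)
  (hx : ∀ a : A, ∑ i, x i * ι (τ (y i * a)) = a)
  (hy : ∀ a : A, ∑ i, ι (τ (a * x i)) * y i = a)

include hx hy in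
/-- The counit `φ ↦ ∑ xᵢ φ(yᵢ)` is `A`-linear, because `∑ xᵢ ⊗ yᵢ a = ∑ a xᵢ ⊗ yᵢ` over `R`. -/
lemma sum_smul_apply_mul {M : Type*} [AddCommGroup M] [Module A M] (φ : A →+ M)
    (hφ : ∀ (r : R) (a : A), φ (ι r * a) = ι r • φ a) (a : A) :
    ∑ i, x i • φ (y i * a) = a • ∑ i, x i • φ (y i) := by
  have h (i : Fin k) : φ (y i * a) = ∑ j, ι (τ (y i * a * x j)) • φ (y j) := by
    conv_lhs => rw [← hy (y i * a), map_sum]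
    simp_rw [hφ]
  simp_rw [h, Finset.smul_sum, smul_smul]
  rw [Finset.sum_comm]
  simp_rw [← Finset.sum_smul, mul_assoc (y _) a, hx]

include hx in
lemma sum_smul_smul {M : Type*} [AddCommGroup M] [Module A M] (m : M) :
    ∑ i, x i • ι (τ (y i)) • m = m := by
  have h := hx 1
  simp only [mul_one] at h
  simp_rw [smul_smul, ← Finset.sum_smul, h, one_smul]

/-- The map `N → Hom_R(A, N)` which sends `n` to `a ↦ τ(a) n`. -/
noncomputable def frobeniusUnit (N : ModuleCat.{max u₁ u₂ w} R) :
    N ⟶ (ModuleCat.restrictScalars ι).obj ((ModuleCat.coextendScalars ι).obj N) :=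
  ModuleCat.ofHom (Y := (ModuleCat.restrictScalars ι).obj ((ModuleCat.coextendScalars ι).obj N))
    { toFun n := coextendMk (((AddMonoidHom.flip (smulAddHom R N)) n).comp τ) fun r a => by
        change τ (ι r * a) • n = r • τ a • n
        rw [hτl, mul_smul]
      map_add' m n := coextendEval_ext fun a => smul_add (τ a) m n
      map_smul' r n := coextendEval_ext fun a => by
        change τ a • r • n = τ (a * ι r) • n
        rw [hτr, mul_smul] }

/-- The map `Hom_R(A, M) → M` which sends `φ` to the sum of the `xᵢ φ(yᵢ)`. -/
noncomputable def frobeniusCounit (M : ModuleCat.{max u₁ u₂ w} A) :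
    (ModuleCat.coextendScalars ι).obj ((ModuleCat.restrictScalars ι).obj M) ⟶ M :=
  ModuleCat.ofHom
    (X := (ModuleCat.coextendScalars ι).obj ((ModuleCat.restrictScalars ι).obj M))
    { toFun φ := ∑ i, x i • (show M from coextendEval φ (y i))
      map_add' φ ψ := by
        rw [← Finset.sum_add_distrib]
        exact Finset.sum_congr rfl fun i _ => smul_add (x i) (show M from coextendEval φ (y i)) _
      map_smul' a φ := sum_smul_apply_mul hx hy
        (coextendEval φ : A →+ (ModuleCat.restrictScalars ι).obj M) (coextendEval_mul φ) a }

end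

/-- For a Frobenius extension, coextension of scalars is left adjoint to restriction of scalars. -/
lemma IsFrobeniusExtension.nonempty_adjunction (hι : IsFrobeniusExtension ι) :
    Nonempty (ModuleCat.coextendScalars.{u₁, u₂, max u₁ u₂ w} ι ⊣
      ModuleCat.restrictScalars.{max u₁ u₂ w} ι) := by
  obtain ⟨τ, k, x, y, hτ, hx, hy⟩ := hι.exists_system
  have hτl (r : R) (a : A) : τ (ι r * a) = r * τ a := by simpa using hτ r 1 a
  have hτr (a : A) (r : R) : τ (a * ι r) = τ a * r := by simpa using hτ 1 r a
  refine ⟨Adjunction.mkOfUnitCounit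
    { unit :=
        { app := frobeniusUnit hτl hτr
          naturality := fun N N' g => ?_ }
      counit :=
        { app := frobeniusCounit hx hy
          naturality := fun M M' g => ?_ }
      left_triangle := ?_
      right_triangle := ?_ }⟩
  · refine ModuleCat.hom_ext (LinearMap.ext fun n => coextendEval_ext fun a => ?_)
    exact (g.hom.map_smul (τ a) n).symm
  · refine ModuleCat.hom_ext (LinearMap.ext fun φ => ?_)
    exact ((map_sum g.hom (fun i => x i • (show M from coextendEval φ (y i))) Finset.univ).trans
      (Finset.sum_congr rfl fun i _ => g.hom.map_smul _ _)).symm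
  · ext N : 2
    refine ModuleCat.hom_ext (LinearMap.ext fun φ => coextendEval_ext fun a => ?_)
    refine (coextendEval_sum _ _ a).trans ?_
    change ∑ i, τ (a * x i) • coextendEval φ (y i) = coextendEval φ a
    simp_rw [← coextendEval_mul, ← map_sum, hy]
  · ext M : 2
    refine ModuleCat.hom_ext (LinearMap.ext fun m => ?_)
    exact sum_smul_smul hx (M := M) m

end FrobeniusExtensions

theorem proposition3p1 {R : Type u₁} {A : Type u₂} [Ring R] [Ring A] (ι : R →+* A)
    (hι : IsFrobeniusExtension ι) (M : ModuleCat.{max u₁ u₂ w} A) :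
    (gorensteinProjectiveDimension M < ⊤ →
      gorensteinProjectiveDimension M =
        gorensteinProjectiveDimension ((ModuleCat.restrictScalars ι).obj M)) ∧
    (gorensteinInjectiveDimension M < ⊤ →
      gorensteinInjectiveDimension M =
        gorensteinInjectiveDimension ((ModuleCat.restrictScalars ι).obj M)) := by
  obtain ⟨adj⟩ := hι.nonempty_adjunction
  have adj' := ModuleCat.restrictCoextendScalarsAdj.{max u₁ w, u₁, u₂} ι
  have : Small.{max u₁ u₂ w} R := small_max.{max u₂ w} R
  have : Small.{max u₁ u₂ w} A := small_max.{max u₁ w} A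
  exact ⟨gorensteinProjectiveDimension_eq_of_adjunctions adj' adj,
    gorensteinInjectiveDimension_eq_of_adjunctions adj' adj⟩
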